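/- \textbf{Definitions.} Graphs are simple and non-oriented unless said otherwise. A \emph{subdivision} of a graph $H$ is a graph obtained from $H$ by replacing some of its edges by paths of length at least $1$ (internally disjoint from each other and from $V(H)$); in particular $H$ is a subdivision of itself. In a tree $T$ rooted at $r$, a \emph{branch starting at} $x_1$ is a path $x_1,\dots,x_k$ such that each $x_i$ is the parent of $x_{i+1}$. A \emph{Burling tree} is a tuple $(T,r,\ell,c)$ where $T$ is a tree rooted at $r$; $\ell$ assigns to each vertex of $T$ that is not a leaf one of its children, called its \emph{last-born}; and $c$ assigns to each vertex $v$ of $T$ a set $c(v)\subseteq V(T)$ such that $c(v)=\varnothing$ if $v$ is the root or a last-born, and otherwise $c(v)$ is the vertex set of a (possibly empty) branch starting at the last-born of the parent of $v$. The graph \emph{fully derived} from it has vertex set $V(T)$, and $u,v$ are adjacent if and only if $v\in c(u)$ or $u\in c(v)$. A graph is \emph{derived} if it is (isomorphic to) an induced subgraph of the graph fully derived from some Burling tree. The \emph{Burling sequence} is the sequence of graphs $G_1,G_2,\dots$ obtained together with sets $\mathcal S_k$ of stable sets of $G_k$ as follows: $G_1$ is the one-vertex graph and $\mathcal S_1=\{V(G_1)\}$.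 Given $(G_k,\mathcal S_k)$, the graph $G_{k+1}$ is the disjoint union of $G_k$ and of one copy $G_S$ of $G_k$ for each $S\in\mathcal S_k$, together with, for all $S,Q\in\mathcal S_k$, a new vertex $v_{S,Q}$ adjacent exactly to the vertices of the copy $Q_S$ of $Q$ in $G_S$; and $\mathcal S_{k+1}$ consists of the sets $S\cup Q_S$ and $S\cup\{v_{S,Q}\}$ for all $S,Q\in\mathcal S_k$. A \emph{Burling graph} is a graph isomorphic to an induced subgraph of some $G_k$. \textbf{Theorem.} No subdivision of $K_5$ is a derived graph, and no subdivision of $K_5$ is a Burling graph. -/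

import Mathlib

universe u v w

/-! ### Subdivisions of graphs -/

/-- `G` is a subdivision of `H`: it is obtained from `H` by replacing every edge `xy` of `H` by a
path `P x y` (of length at least one) between the branch vertices `φ x` and `φ y`. The paths meet
each other and the branch vertices only in common ends, and `G` has no vertices or edges other
than the branch vertices and those of the paths. -/
def IsSubdivisionOf {U : Type u} {V : Type v} (G : SimpleGraph V) (H : SimpleGraph U) : Prop :=
  ∃ (φ : U ↪ V) (P : ∀ x y : U, H.Adj x y → G.Walk (φ x) (φ y)),
    (∀ x y h, (P x y h).IsPath) ∧
    (∀ x y (h : H.Adj x y), P y x h.symm = (P x y h).reverse) ∧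
    (∀ x y h z, φ z ∈ (P x y h).support → z = x ∨ z = y) ∧
    (∀ x y h x' y' h', s(x, y) ≠ s(x', y') →
      ∀ a, a ∈ (P x y h).support → a ∈ (P x' y' h').support → a ∈ Set.range φ) ∧
    (∀ a : V, a ∈ Set.range φ ∨ ∃ x y h, a ∈ (P x y h).support) ∧
    (∀ e ∈ G.edgeSet, ∃ x y h, e ∈ (P x y h).edges)

/-! ### Burling trees and derived graphs -/

/-- In the tree `T` rooted at `r`, the vertex `x` is the parent of `y` (and `y` a child of `x`). -/
def IsParentIn {W : Type w} (T : SimpleGraph W) (r x y : W) : Prop :=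
  T.Adj x y ∧ T.dist r y = T.dist r x + 1

/-- `B` is the vertex set of a nonempty branch of the tree `T` rooted at `r` that starts at `x`:
a path `x = x₁, x₂, …, xₖ`, `k ≥ 1`, in which each `xᵢ` is the parent of `xᵢ₊₁`. -/
def IsBranchFrom {W : Type w} (T : SimpleGraph W) (r x : W) (B : Set W) : Prop :=
  ∃ l : List W, List.IsChain (IsParentIn T r) (x :: l) ∧ B = {y | y ∈ x :: l}

/-- A Burling tree with vertex set `W`. The value of `lastBorn` matters only at vertices that
are not leaves (that is, that have a child). -/
structure BurlingTree (W : Type w) where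
  /-- the underlying tree -/
  tree : SimpleGraph W
  isTree : tree.IsTree
  /-- the root -/
  root : W
  /-- the last-born child of each vertex that is not a leaf -/
  lastBorn : W → W
  isParent_lastBorn : ∀ x, (∃ y, IsParentIn tree root x y) → IsParentIn tree root x (lastBorn x)
  /-- the choose function -/
  choosePath : W → Set W
  choosePath_root : choosePath root = ∅
  choosePath_lastBorn : ∀ p x, IsParentIn tree root p x → lastBorn p = x → choosePath x = ∅
  choosePath_of_ne : ∀ p x, IsParentIn tree root p x → lastBorn p ≠ x →
    choosePath x = ∅ ∨ IsBranchFrom tree root (lastBorn p) (choosePath x)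

/-- The oriented graph fully derived from a Burling tree: there is an arc from `x` to `y` if and
only if `y` is in `choosePath x`. -/
def BurlingTree.fullyDerivedOriented {W : Type w} (T : BurlingTree W) : Digraph W where
  Adj x y := y ∈ T.choosePath x

/-- The non-oriented graph fully derived from a Burling tree. -/
def BurlingTree.fullyDerived {W : Type w} (T : BurlingTree W) : SimpleGraph W :=
  T.fullyDerivedOriented.toSimpleGraphInclusive

/-- `G` is a (non-oriented) derived graph: it is isomorphic to an induced subgraph of the
graph fully derived from some Burling tree. -/
def IsDerived {V : Type v} (G : SimpleGraph V) : Prop :=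
  ∃ (W : Type w) (T : BurlingTree W), Nonempty (G ↪g T.fullyDerived)

/-! ### The Burling sequence and Burling graphs -/

/-- A graph with a set of stable sets of it. -/
structure StablePair where
  /-- the vertex set of the graph -/
  V : Type
  /-- the graph -/
  graph : SimpleGraph V
  /-- the set of stable sets -/
  sets : Set (Set V)
  stable : ∀ S ∈ sets, graph.IsIndepSet S

namespace StablePair

/-- The vertices of the next pair: those of the graph `G` itself, those of a copy `G_S` of `G`
for every `S` in the set of stable sets, and for all `S` and `Q` in it a new vertex. -/
inductive NextVertex (P : StablePair) : Type
  | base (x : P.V)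
  | copy (S : P.sets) (x : P.V)
  | new (S Q : P.sets)

/-- Edges of the next graph, listed in one direction: those of `G`, those of each copy `G_S`, and
those from the new vertex of `S` and `Q` to all vertices of the copy of `Q` in `G_S`. -/
inductive NextRel (P : StablePair) : P.NextVertex → P.NextVertex → Prop
  | base {x y : P.V} : P.graph.Adj x y → NextRel P (.base x) (.base y)
  | copy (S : P.sets) {x y : P.V} : P.graph.Adj x y → NextRel P (.copy S x) (.copy S y)
  | new (S Q : P.sets) {x : P.V} : x ∈ Q.1 → NextRel P (.new S Q) (.copy S x)

/-- The next pair. Its stable sets are, for all `S` and `Q`, the sets `S ∪ Q` and `S ∪ {v}`, where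
`S` is taken in `G`, `Q` is taken in the copy `G_S`, and `v` is the new vertex of `S` and `Q`. -/
def next (P : StablePair) : StablePair where
  V := P.NextVertex
  graph := SimpleGraph.fromRel P.NextRel
  sets := {A | ∃ S Q : P.sets,
    A = NextVertex.base '' S.1 ∪ NextVertex.copy S '' Q.1 ∨
    A = NextVertex.base '' S.1 ∪ {NextVertex.new S Q}}
  stable := by
    rintro A ⟨S, Q, rfl | rfl⟩
    · rintro a (⟨x, hx, rfl⟩ | ⟨x, hx, rfl⟩) b (⟨y, hy, rfl⟩ | ⟨y, hy, rfl⟩) hab ⟨-, h | h⟩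
      · cases h with | base h => exact P.stable _ S.2 hx hy h.ne h
      · cases h with | base h => exact P.stable _ S.2 hy hx h.ne h
      · cases h
      · cases h
      · cases h
      · cases h
      · cases h with | copy _ h => exact P.stable _ Q.2 hx hy h.ne h
      · cases h with | copy _ h => exact P.stable _ Q.2 hy hx h.ne h
    · rintro a (⟨x, hx, rfl⟩ | rfl) b (⟨y, hy, rfl⟩ | rfl) hab ⟨-, h | h⟩
      · cases h with | base h => exact P.stable _ S.2 hx hy h.ne h
      · cases h with | base h => exact P.stable _ S.2 hy hx h.ne h
      all_goals cases h

/-- The one-vertex graph, with the set of all its vertices as its only stable set. -/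
def single : StablePair where
  V := Unit
  graph := ⊥
  sets := {Set.univ}
  stable := by
    rintro S - x - y - h
    exact absurd (Subsingleton.elim x y) h

/-- The Burling sequence. -/
def burlingSeq : ℕ → StablePair
  | 0 => single
  | n + 1 => (burlingSeq n).next

end StablePair

/-- `G` is a Burling graph: it is isomorphic to an induced subgraph of a graph of the Burling
sequence. -/
def IsBurling {V : Type v} (G : SimpleGraph V) : Prop :=
  ∃ n : ℕ, Nonempty (G ↪g (StablePair.burlingSeq n).graph)

/-!
# No subdivision of `K₅` is a derived graph or a Burling graph

Both classes of graphs carry a *Burling order* (`IsBurlingOrder`): a forest order `lt`, in which the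
larger elements are the ancestors, and an acyclic orientation `arc` of the edges satisfying a few
compatibility axioms. For derived graphs it is read off the Burling tree; along the Burling
sequence it is built by induction, the chosen stable sets being branches of the forest
(`StablePair.HasOrder`). It therefore suffices to show that a subdivision of `K₅` has no Burling
order.

The out-neighbours of a vertex are pairwise comparable, comparable vertices are not adjacent, and
the set of vertices below `w` is joined to the rest of the graph only through in-neighbours of `w`
(`IsBurlingOrder.lt_iff_lt_of_adj`). So every vertex `w` with something below it gives a star
cutset, or the whole graph consists of `w`, its in-neighbours and the vertices below it. In a
subdivision of a complete graph this is very restrictive: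

* if `w` is a subdivision vertex, all vertices but `w` and its in-neighbours are below `w`
  (`eq_or_arc_or_lt_of_interior`);
* if `w` is a branch vertex with no branch vertex below it, what is below `w` consists of interiors
  of paths that join branch in-neighbours of `w` (`exists_path_of_lt_of_small`);
* if `w` is a branch vertex with a branch vertex below it, at most one path avoiding `w` is not
  made of in-neighbours of `w` and vertices below `w` (`arc_or_lt_of_not_outside`,
  `outside_unique`).

Since arcs are acyclic, every cycle has a vertex with two out-neighbours `u' < u` on the cycle
(`exists_source`). If the cycle corresponds to a triangle of `K₅` and no branch vertex is below `u`,
then `u` is a branch vertex of it, an *apex* of the triangle (`exists_apex`). Two triangles with a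
common edge cannot both have an apex (`IsApex.false_of_common_edge`). To find two such triangles,
take a lowest vertex `s` that has a branch vertex below it: by the description above, two triangles
with a common edge lie among the in-neighbours of `s` and the vertices below `s`, where every
possible `u` has no branch vertex below it. If there is no such `s`, any two triangles with a
common edge will do.
-/

/-! ### Burling orders -/

/-- Axioms for the pair of relations that a Burling tree induces on its vertices: `lt x y` says that
`y` is a proper ancestor of `x`, and `arc x y` says that `y` is in the chosen branch of `x`.
In contrast to Burling trees, these axioms pass to arbitrary subsets. -/
structure IsBurlingOrder {V : Type*} (lt arc : V → V → Prop) : Prop where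
  trans : ∀ {x y z}, lt x y → lt y z → lt x z
  irrefl : ∀ x, ¬ lt x x
  comparable_of_lt : ∀ {x y z}, lt x y → lt x z → y = z ∨ lt y z ∨ lt z y
  comparable_of_arc : ∀ {x y z}, arc x y → arc x z → y = z ∨ lt y z ∨ lt z y
  lt_of_arc_of_lt : ∀ {x y z}, arc x y → lt x z → lt y z
  arc_or_lt : ∀ {x y z}, arc x y → lt y z → arc x z ∨ lt x z
  acyclic : ∀ x, ¬ Relation.TransGen arc x x

/-- `G` is the underlying graph of the arcs of a Burling order on its vertices. -/
def HasBurlingOrder {V : Type*} (G : SimpleGraph V) : Prop :=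
  ∃ lt arc : V → V → Prop, IsBurlingOrder lt arc ∧ ∀ x y, G.Adj x y ↔ arc x y ∨ arc y x

theorem HasBurlingOrder.of_embedding {V V' : Type*} {G : SimpleGraph V} {G' : SimpleGraph V'}
    (e : G ↪g G') (h : HasBurlingOrder G') : HasBurlingOrder G := by
  obtain ⟨lt, arc, h, hadj⟩ := h
  refine ⟨fun x y => lt (e x) (e y), fun x y => arc (e x) (e y), ?_, fun x y => ?_⟩
  · exact
    { trans := h.trans
      irrefl := fun x => h.irrefl _
      comparable_of_lt := fun h1 h2 => by
        simpa only [e.injective.eq_iff] using h.comparable_of_lt h1 h2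
      comparable_of_arc := fun h1 h2 => by
        simpa only [e.injective.eq_iff] using h.comparable_of_arc h1 h2
      lt_of_arc_of_lt := h.lt_of_arc_of_lt
      arc_or_lt := h.arc_or_lt
      acyclic := fun x hx => h.acyclic (e x) (hx.lift e (fun _ _ hab => hab)) }
  · rw [← hadj, e.map_adj_iff]

namespace IsBurlingOrder

variable {V : Type*} {lt arc : V → V → Prop} (h : IsBurlingOrder lt arc)
include h

theorem asymm_arc {x y : V} (h1 : arc x y) (h2 : arc y x) : False :=
  h.acyclic x (.tail (.single h1) h2)

theorem not_lt_of_arc {x y : V} (h1 : arc x y) : ¬ lt x y := fun h2 =>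
  h.irrefl y (h.lt_of_arc_of_lt h1 h2)

theorem not_gt_of_arc {x y : V} (h1 : arc x y) : ¬ lt y x := fun h2 =>
  (h.arc_or_lt h1 h2).elim (fun h3 => h.asymm_arc h3 h3) (h.irrefl x)

/-- The set of vertices below `w` is a union of connected components of the graph from which the
in-neighbours of `w` are deleted. -/
theorem lt_iff_lt_of_adj {a b w : V} (hab : arc a b ∨ arc b a) (ha : ¬ arc a w) (hb : ¬ arc b w) :
    lt a w ↔ lt b w := by
  rcases hab with hab | hab
  · exact ⟨h.lt_of_arc_of_lt hab, fun h2 => (h.arc_or_lt hab h2).resolve_left ha⟩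
  · exact ⟨fun h2 => (h.arc_or_lt hab h2).resolve_left hb, h.lt_of_arc_of_lt hab⟩

theorem lt_or_lt_of_arc {x y z : V} (hy : arc x y) (hz : arc x z) (hne : y ≠ z) :
    lt y z ∨ lt z y :=
  (h.comparable_of_arc hy hz).resolve_left hne

end IsBurlingOrder

/-! ### Burling trees induce Burling orders -/

namespace BurlingTree

variable {W : Type w} (T : BurlingTree W)

theorem parent_unique {x x' y : W} (h : IsParentIn T.tree T.root x y)
    (h' : IsParentIn T.tree T.root x' y) : x = x' := by
  obtain ⟨p, hp⟩ := T.isTree.connected.exists_walk_length_eq_dist T.root y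
  have hpp := p.isPath_of_length_eq_dist hp
  have key : ∀ z, IsParentIn T.tree T.root z y → z = p.penultimate := by
    intro z hz
    refine T.isTree.isAcyclic.eq_penultimate_of_adj_end hpp hz.1.symm ?_
    obtain ⟨q, hq⟩ := T.isTree.connected.exists_walk_length_eq_dist T.root z
    have hq' : (q.concat hz.1).IsPath := by
      apply SimpleGraph.Walk.isPath_of_length_eq_dist
      rw [SimpleGraph.Walk.length_concat, hq, hz.2]
    have := (T.isTree.isAcyclic.subsingleton_path T.root y).elim ⟨p, hpp⟩ ⟨_, hq'⟩
    rw [Subtype.mk.injEq] at this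
    rw [this, SimpleGraph.Walk.support_concat]
    simp
  rw [key x h, key x' h']

theorem exists_parent {y : W} (hy : y ≠ T.root) : ∃ x, IsParentIn T.tree T.root x y := by
  obtain ⟨p, hp⟩ := T.isTree.connected.exists_walk_length_eq_dist T.root y
  have hn : ¬ p.Nil := fun hn => hy hn.eq.symm
  have hadj := p.adj_penultimate hn
  refine ⟨p.penultimate, hadj, ?_⟩
  have h1 : T.tree.dist T.root p.penultimate ≤ p.length - 1 := by
    refine (SimpleGraph.dist_le p.dropLast).trans ?_
    simp
  have h2 : T.tree.dist T.root y ≤ T.tree.dist T.root p.penultimate + 1 := by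
    have := T.isTree.connected.dist_triangle (u := T.root) (v := p.penultimate) (w := y)
    rwa [SimpleGraph.dist_eq_one_iff_adj.2 hadj] at this
  have h3 : 0 < p.length := SimpleGraph.Walk.not_nil_iff_lt_length.1 hn
  omega

/-- `T.Below y x` says that `x` is a proper ancestor of `y`. -/
def Below (y x : W) : Prop := Relation.TransGen (IsParentIn T.tree T.root) x y

variable {T}

theorem Below.dist_lt {x y : W} (h : T.Below y x) :
    T.tree.dist T.root x < T.tree.dist T.root y := by
  induction h with
  | single h => have := h.2; omega
  | tail _ h ih => have := h.2; omega

theorem Below.of_parent {p x z : W} (hp : IsParentIn T.tree T.root p x) (h : T.Below x z) :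
    z = p ∨ T.Below p z := by
  cases h with
  | single h => exact .inl (T.parent_unique h hp)
  | tail h h' => rw [T.parent_unique h' hp] at h; exact .inr h

theorem Below.comparable {x y z : W} (hy : T.Below x y) (hz : T.Below x z) :
    y = z ∨ T.Below y z ∨ T.Below z y := by
  induction hy with
  | single h =>
    rcases hz.of_parent h with rfl | h'
    · exact .inl rfl
    · exact .inr (.inl h')
  | tail hyb hbc ih =>
    rcases hz.of_parent hbc with rfl | h'
    · exact .inr (.inr hyb)
    · exact ih h'

theorem eq_or_below_of_mem_chain {l : List W} : ∀ {x y : W},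
    List.IsChain (IsParentIn T.tree T.root) (x :: l) → y ∈ x :: l → y = x ∨ T.Below y x := by
  induction l with
  | nil => intro x y _ hy; exact .inl (by simpa using hy)
  | cons a l ih =>
    intro x y hl hy
    rw [List.isChain_cons_cons] at hl
    rcases List.mem_cons.1 hy with rfl | hy
    · exact .inl rfl
    · rcases ih hl.2 hy with rfl | h
      · exact .inr (.single hl.1)
      · exact .inr (.head hl.1 h)

theorem comparable_of_mem_chain {l : List W} : ∀ {x y z : W},
    List.IsChain (IsParentIn T.tree T.root) (x :: l) → y ∈ x :: l → z ∈ x :: l →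
    y = z ∨ T.Below y z ∨ T.Below z y := by
  induction l with
  | nil => intro x y z _ hy hz; simp at hy hz; exact .inl (hy.trans hz.symm)
  | cons a l ih =>
    intro x y z hl hy hz
    rcases List.mem_cons.1 hy with rfl | hy'
    · rcases eq_or_below_of_mem_chain hl hz with rfl | h
      · exact .inl rfl
      · exact .inr (.inr h)
    rcases List.mem_cons.1 hz with rfl | hz'
    · rcases eq_or_below_of_mem_chain hl hy with rfl | h
      · exact .inl rfl
      · exact .inr (.inl h)
    rw [List.isChain_cons_cons] at hl
    exact ih hl.2 hy' hz'

theorem mem_chain_or_below {l : List W} : ∀ {x y z : W},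
    List.IsChain (IsParentIn T.tree T.root) (x :: l) → y ∈ x :: l → T.Below y z →
    z ∈ x :: l ∨ T.Below x z := by
  induction l with
  | nil => intro x y z _ hy hz; simp at hy; subst hy; exact .inr hz
  | cons a l ih =>
    intro x y z hl hy hz
    rcases List.mem_cons.1 hy with rfl | hy'
    · exact .inr hz
    rw [List.isChain_cons_cons] at hl
    rcases ih hl.2 hy' hz with h | h
    · exact .inl (List.mem_cons_of_mem _ h)
    · rcases h.of_parent hl.1 with rfl | h
      · exact .inl List.mem_cons_self
      · exact .inr h

/-- The shape of a nonempty chosen branch. -/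
theorem exists_chain_of_mem_choosePath {x y : W} (h : y ∈ T.choosePath x) :
    ∃ p l, IsParentIn T.tree T.root p x ∧ T.lastBorn p ≠ x ∧
      IsParentIn T.tree T.root p (T.lastBorn p) ∧
      List.IsChain (IsParentIn T.tree T.root) (T.lastBorn p :: l) ∧
      ∀ z, z ∈ T.choosePath x ↔ z ∈ T.lastBorn p :: l := by
  have hroot : x ≠ T.root := by rintro rfl; simp [T.choosePath_root] at h
  obtain ⟨p, hp⟩ := T.exists_parent hroot
  have hne : T.lastBorn p ≠ x := fun he => by simp [T.choosePath_lastBorn p x hp he] at h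
  rcases T.choosePath_of_ne p x hp hne with h0 | ⟨l, hl, hB⟩
  · simp [h0] at h
  · exact ⟨p, l, hp, hne, T.isParent_lastBorn p ⟨x, hp⟩, hl, fun z => by rw [hB]; rfl⟩

/-- A directed path starting at `x` stays in the subtree of the last-born sibling of `x`. -/
theorem eq_or_below_lastBorn_of_transGen {p x y : W} (hp : IsParentIn T.tree T.root p x)
    (h : Relation.TransGen (fun a b => b ∈ T.choosePath a) x y) :
    T.lastBorn p ≠ x ∧ (y = T.lastBorn p ∨ T.Below y (T.lastBorn p)) := by
  induction h with
  | single h =>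
    obtain ⟨p', l, hp', hne, -, hl, hmem⟩ := exists_chain_of_mem_choosePath h
    obtain rfl := T.parent_unique hp hp'
    exact ⟨hne, eq_or_below_of_mem_chain hl ((hmem _).1 h)⟩
  | @tail b c _ hbc ih =>
    obtain ⟨hne, ih⟩ := ih
    refine ⟨hne, .inr ?_⟩
    obtain ⟨p', l, hp', hne', hlb, hl, hmem⟩ := exists_chain_of_mem_choosePath hbc
    have hc : T.Below c p' := by
      rcases eq_or_below_of_mem_chain hl ((hmem _).1 hbc) with rfl | h
      · exact .single hlb
      · exact .head hlb h
    rcases ih with rfl | ih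
    · have hpl := T.isParent_lastBorn p ⟨x, hp⟩
      exact absurd (by rw [T.parent_unique hp' hpl]) hne'
    · rcases ih.of_parent hp' with h | h
      · rwa [h]
      · exact .trans h hc

variable (T)

theorem isBurlingOrder : IsBurlingOrder T.Below (fun x y => y ∈ T.choosePath x) where
  trans h1 h2 := h2.trans h1
  irrefl x hx := hx.dist_lt.false
  comparable_of_lt h1 h2 := h1.comparable h2
  comparable_of_arc h1 h2 := by
    obtain ⟨p, l, hp, -, hlb, hl, hmem⟩ := exists_chain_of_mem_choosePath h1
    exact comparable_of_mem_chain hl ((hmem _).1 h1) ((hmem _).1 h2)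
  lt_of_arc_of_lt {x y z} h1 h2 := by
    obtain ⟨p, l, hp, -, hlb, hl, hmem⟩ := exists_chain_of_mem_choosePath h1
    have hyp : T.Below y p := by
      rcases eq_or_below_of_mem_chain hl ((hmem _).1 h1) with rfl | h
      · exact .single hlb
      · exact .head hlb h
    rcases h2.of_parent hp with rfl | h
    · exact hyp
    · exact .trans h hyp
  arc_or_lt h1 h2 := by
    obtain ⟨p, l, hp, -, hlb, hl, hmem⟩ := exists_chain_of_mem_choosePath h1
    rcases mem_chain_or_below hl ((hmem _).1 h1) h2 with h | h
    · exact .inl ((hmem _).2 h)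
    · rcases h.of_parent hlb with rfl | h
      · exact .inr (.single hp)
      · exact .inr (.tail h hp)
  acyclic x hx := by
    have hroot : x ≠ T.root := by
      rintro rfl
      obtain ⟨y, hy, -⟩ := Relation.TransGen.head'_iff.1 hx
      simp [T.choosePath_root] at hy
    obtain ⟨p, hp⟩ := T.exists_parent hroot
    have hpl := T.isParent_lastBorn p ⟨x, hp⟩
    obtain ⟨hne, h | h⟩ := eq_or_below_lastBorn_of_transGen hp hx
    · exact hne h.symm
    · have h1 := h.dist_lt
      have h2 := hp.2
      have h3 := hpl.2
      omega

theorem hasBurlingOrder_fullyDerived : HasBurlingOrder T.fullyDerived := by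
  refine ⟨_, _, T.isBurlingOrder, fun x y => ?_⟩
  refine ⟨fun h => h.2, fun h => ⟨?_, h⟩⟩
  rintro rfl
  exact T.isBurlingOrder.acyclic x (.single (h.elim id id))

end BurlingTree

/-! ### The Burling sequence carries Burling orders -/

namespace StablePair

/-- The invariant of the Burling sequence: the graph has a Burling order in which every chosen
stable set is a chain that contains all vertices above its members. -/
def HasOrder (P : StablePair) : Prop :=
  ∃ lt arc : P.V → P.V → Prop, IsBurlingOrder lt arc ∧
    (∀ x y, P.graph.Adj x y ↔ arc x y ∨ arc y x) ∧
    ∀ S ∈ P.sets, (∀ x ∈ S, ∀ y, lt x y → y ∈ S) ∧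
      ∀ x ∈ S, ∀ y ∈ S, x = y ∨ lt x y ∨ lt y x

/-- The order of the next graph: the copy of the graph indexed by a stable set `S`, and the new
vertices of `S`, are hung below the branch `S`. -/
inductive NextLt (P : StablePair) (lt : P.V → P.V → Prop) : P.NextVertex → P.NextVertex → Prop
  | base {x y : P.V} : lt x y → NextLt P lt (.base x) (.base y)
  | copy (S : P.sets) {x y : P.V} : lt x y → NextLt P lt (.copy S x) (.copy S y)
  | copyBase (S : P.sets) {x y : P.V} : y ∈ S.1 → NextLt P lt (.copy S x) (.base y)
  | newBase (S Q : P.sets) {y : P.V} : y ∈ S.1 → NextLt P lt (.new S Q) (.base y)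

/-- The arcs of the next graph: those of the graph and its copies, and those from a new vertex. -/
inductive NextArc (P : StablePair) (arc : P.V → P.V → Prop) : P.NextVertex → P.NextVertex → Prop
  | base {x y : P.V} : arc x y → NextArc P arc (.base x) (.base y)
  | copy (S : P.sets) {x y : P.V} : arc x y → NextArc P arc (.copy S x) (.copy S y)
  | new (S Q : P.sets) {x : P.V} : x ∈ Q.1 → NextArc P arc (.new S Q) (.copy S x)

theorem NextArc.transGen_inv {P : StablePair} {arc : P.V → P.V → Prop} {a b : P.NextVertex}
    (h : Relation.TransGen (P.NextArc arc) a b) :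
    (∃ x y, a = .base x ∧ b = .base y ∧ Relation.TransGen arc x y) ∨
    (∃ S x y, a = .copy S x ∧ b = .copy S y ∧ Relation.TransGen arc x y) ∨
    (∃ S Q x, a = .new S Q ∧ b = .copy S x) := by
  induction h with
  | single h =>
    cases h with
    | base h => exact .inl ⟨_, _, rfl, rfl, .single h⟩
    | copy S h => exact .inr (.inl ⟨_, _, _, rfl, rfl, .single h⟩)
    | new S Q h => exact .inr (.inr ⟨_, _, _, rfl, rfl⟩)
  | tail _ h ih =>
    rcases ih with ⟨x, y, rfl, rfl, ht⟩ | ⟨S, x, y, rfl, rfl, ht⟩ | ⟨S, Q, x, rfl, rfl⟩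
    · cases h with | base h => exact .inl ⟨_, _, rfl, rfl, ht.tail h⟩
    · cases h with | copy S h => exact .inr (.inl ⟨_, _, _, rfl, rfl, ht.tail h⟩)
    · cases h with | copy S h => exact .inr (.inr ⟨_, _, _, rfl, rfl⟩)

theorem HasOrder.next {P : StablePair} (hP : P.HasOrder) : P.next.HasOrder := by
  obtain ⟨lt, arc, h, hadj, hS⟩ := hP
  have up : ∀ (S : P.sets) {x y}, x ∈ S.1 → lt x y → y ∈ S.1 := fun S x y hx hxy =>
    (hS S.1 S.2).1 x hx y hxy
  have chain : ∀ (S : P.sets) {x y}, x ∈ S.1 → y ∈ S.1 → x = y ∨ lt x y ∨ lt y x :=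
    fun S x y hx hy => (hS S.1 S.2).2 x hx y hy
  have chainBase : ∀ (S : P.sets) {x y}, x ∈ S.1 → y ∈ S.1 →
      NextVertex.base x = NextVertex.base y ∨ P.NextLt lt (.base x) (.base y) ∨
      P.NextLt lt (.base y) (.base x) := fun S x y hx hy =>
    (chain S hx hy).imp (congrArg _) (Or.imp .base .base)
  refine ⟨P.NextLt lt, P.NextArc arc, ?_, ?_, ?_⟩
  · constructor
    · intro x y z h1 h2
      cases h1 with
      | base h1 => cases h2 with | base h2 => exact .base (h.trans h1 h2)
      | copy S h1 =>
        cases h2 with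
        | copy _ h2 => exact .copy S (h.trans h1 h2)
        | copyBase _ h2 => exact .copyBase S h2
      | copyBase S h1 => cases h2 with | base h2 => exact .copyBase S (up S h1 h2)
      | newBase S Q h1 => cases h2 with | base h2 => exact .newBase S Q (up S h1 h2)
    · intro x hx
      cases hx with
      | base hx => exact h.irrefl _ hx
      | copy S hx => exact h.irrefl _ hx
    · intro x y z h1 h2
      cases h1 with
      | base h1 =>
        cases h2 with
        | base h2 => exact (h.comparable_of_lt h1 h2).imp (congrArg _) (Or.imp .base .base)
      | copy S h1 =>
        cases h2 with
        | copy _ h2 =>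
          exact (h.comparable_of_lt h1 h2).imp (congrArg _) (Or.imp (.copy S) (.copy S))
        | copyBase _ h2 => exact .inr (.inl (.copyBase S h2))
      | copyBase S h1 =>
        cases h2 with
        | copy _ h2 => exact .inr (.inr (.copyBase S h1))
        | copyBase _ h2 => exact chainBase S h1 h2
      | newBase S Q h1 => cases h2 with | newBase _ _ h2 => exact chainBase S h1 h2
    · intro x y z h1 h2
      cases h1 with
      | base h1 =>
        cases h2 with
        | base h2 => exact (h.comparable_of_arc h1 h2).imp (congrArg _) (Or.imp .base .base)
      | copy S h1 =>
        cases h2 with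
        | copy _ h2 =>
          exact (h.comparable_of_arc h1 h2).imp (congrArg _) (Or.imp (.copy S) (.copy S))
      | new S Q h1 =>
        cases h2 with
        | new _ _ h2 => exact (chain Q h1 h2).imp (congrArg _) (Or.imp (.copy S) (.copy S))
    · intro x y z h1 h2
      cases h1 with
      | base h1 => cases h2 with | base h2 => exact .base (h.lt_of_arc_of_lt h1 h2)
      | copy S h1 =>
        cases h2 with
        | copy _ h2 => exact .copy S (h.lt_of_arc_of_lt h1 h2)
        | copyBase _ h2 => exact .copyBase S h2
      | new S Q h1 => cases h2 with | newBase _ _ h2 => exact .copyBase S h2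
    · intro x y z h1 h2
      cases h1 with
      | base h1 => cases h2 with | base h2 => exact (h.arc_or_lt h1 h2).imp .base .base
      | copy S h1 =>
        cases h2 with
        | copy _ h2 => exact (h.arc_or_lt h1 h2).imp (.copy S) (.copy S)
        | copyBase _ h2 => exact .inr (.copyBase S h2)
      | new S Q h1 =>
        cases h2 with
        | copy _ h2 => exact .inl (.new S Q (up Q h1 h2))
        | copyBase _ h2 => exact .inr (.newBase S Q h2)
    · intro x hx
      rcases NextArc.transGen_inv hx with ⟨y, z, rfl, he, ht⟩ | ⟨S, y, z, rfl, he, ht⟩ |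
        ⟨S, Q, y, rfl, he⟩
      · cases he; exact h.acyclic _ ht
      · cases he; exact h.acyclic _ ht
      · cases he
  · have key : ∀ a b, P.NextRel a b → P.NextArc arc a b ∨ P.NextArc arc b a := by
      intro a b hab
      cases hab with
      | base hab => exact ((hadj _ _).1 hab).imp .base .base
      | copy S hab => exact ((hadj _ _).1 hab).imp (.copy S) (.copy S)
      | new S Q hab => exact .inl (.new S Q hab)
    have key' : ∀ a b, P.NextArc arc a b → P.next.graph.Adj a b := by
      intro a b hab
      cases hab with
      | base hab =>
        have := (hadj _ _).2 (.inl hab)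
        exact ⟨fun he => this.ne (NextVertex.base.inj he), .inl (.base this)⟩
      | copy S hab =>
        have := (hadj _ _).2 (.inl hab)
        exact ⟨fun he => this.ne (NextVertex.copy.inj he).2, .inl (.copy S this)⟩
      | new S Q hab => exact ⟨(nomatch ·), .inl (.new S Q hab)⟩
    intro a b
    refine ⟨fun hab => hab.2.elim (key a b) fun h2 => (key b a h2).symm, fun hab => ?_⟩
    exact hab.elim (key' a b) fun h2 => (key' b a h2).symm
  · rintro A ⟨S, Q, rfl | rfl⟩
    · constructor
      · rintro a (⟨x, hx, rfl⟩ | ⟨x, hx, rfl⟩) b hab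
        · cases hab with | base hab => exact .inl ⟨_, up S hx hab, rfl⟩
        · cases hab with
          | copy _ hab => exact .inr ⟨_, up Q hx hab, rfl⟩
          | copyBase _ hab => exact .inl ⟨_, hab, rfl⟩
      · rintro a (⟨x, hx, rfl⟩ | ⟨x, hx, rfl⟩) b (⟨y, hy, rfl⟩ | ⟨y, hy, rfl⟩)
        · exact chainBase S hx hy
        · exact .inr (.inr (.copyBase S hx))
        · exact .inr (.inl (.copyBase S hy))
        · exact (chain Q hx hy).imp (congrArg _) (Or.imp (.copy S) (.copy S))
    · constructor
      · rintro a (⟨x, hx, rfl⟩ | rfl) b hab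
        · cases hab with | base hab => exact .inl ⟨_, up S hx hab, rfl⟩
        · cases hab with | newBase _ _ hab => exact .inl ⟨_, hab, rfl⟩
      · rintro a (⟨x, hx, rfl⟩ | rfl) b (⟨y, hy, rfl⟩ | rfl)
        · exact chainBase S hx hy
        · exact .inr (.inr (.newBase S Q hx))
        · exact .inr (.inl (.newBase S Q hy))
        · exact .inl rfl

theorem hasOrder_single : single.HasOrder := by
  refine ⟨fun _ _ => False, fun _ _ => False, ?_, ?_, ?_⟩
  · refine ⟨fun h => h.elim, fun _ h => h, fun h => h.elim, fun h => h.elim, fun h => h.elim,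
      fun h => h.elim, fun x hx => ?_⟩
    obtain ⟨y, hy, -⟩ := Relation.TransGen.head'_iff.1 hx
    exact hy
  · intro x y
    exact ⟨fun h => h.elim, fun h => h.elim id id⟩
  · intro S _
    exact ⟨fun _ _ _ h => h.elim, fun x _ y _ => .inl (Subsingleton.elim (α := Unit) x y)⟩

theorem hasOrder_burlingSeq : ∀ n, (burlingSeq n).HasOrder
  | 0 => hasOrder_single
  | n + 1 => (hasOrder_burlingSeq n).next

end StablePair

theorem IsDerived.hasBurlingOrder {V : Type v} {G : SimpleGraph V} (h : IsDerived.{v, w} G) :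
    HasBurlingOrder G := by
  obtain ⟨W, T, ⟨e⟩⟩ := h
  exact T.hasBurlingOrder_fullyDerived.of_embedding e

theorem IsBurling.hasBurlingOrder {V : Type v} {G : SimpleGraph V} (h : IsBurling G) :
    HasBurlingOrder G := by
  obtain ⟨n, ⟨e⟩⟩ := h
  obtain ⟨lt, arc, h, hadj, -⟩ := StablePair.hasOrder_burlingSeq n
  exact HasBurlingOrder.of_embedding e ⟨lt, arc, h, hadj⟩

/-! ### Subdivisions of complete graphs in coordinates -/

/-- A subdivision of the complete graph on `ι`, with its paths listed by position: for distinct `x`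
and `y` the path between the branch vertices `φ x` and `φ y` is
`f x y 0, f x y 1, …, f x y (len x y)`. The values `f x y t` with `x = y` or `t > len x y` are
irrelevant. -/
structure SubdividedComplete {V : Type*} (G : SimpleGraph V) (ι : Type*) where
  /-- the branch vertices -/
  φ : ι → V
  /-- the lengths of the paths -/
  len : ι → ι → ℕ
  /-- the vertices of the paths -/
  f : ι → ι → ℕ → V
  φ_inj : ∀ {x y}, φ x = φ y → x = y
  f_zero : ∀ {x y}, x ≠ y → f x y 0 = φ x
  f_len : ∀ {x y}, x ≠ y → f x y (len x y) = φ y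
  len_pos : ∀ {x y}, x ≠ y → 0 < len x y
  len_symm : ∀ {x y}, x ≠ y → len y x = len x y
  f_symm : ∀ {x y t}, x ≠ y → t ≤ len x y → f y x (len x y - t) = f x y t
  adj : ∀ {x y t}, x ≠ y → t < len x y → G.Adj (f x y t) (f x y (t + 1))
  inj : ∀ {x y s t}, x ≠ y → s ≤ len x y → t ≤ len x y → f x y s = f x y t → s = t
  branch : ∀ {x y t z}, x ≠ y → t ≤ len x y → f x y t = φ z → z = x ∨ z = y
  meet : ∀ {x y t x' y' t'}, x ≠ y → x' ≠ y' → t ≤ len x y → t' ≤ len x' y' →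
    f x y t = f x' y' t' → s(x, y) = s(x', y') ∨ ∃ z, f x y t = φ z
  cover : ∀ a, ∃ x y t, x ≠ y ∧ t ≤ len x y ∧ a = f x y t
  cover_adj : ∀ {a b}, G.Adj a b → ∃ x y t, x ≠ y ∧ t < len x y ∧ a = f x y t ∧ b = f x y (t + 1)

open Classical in
theorem IsSubdivisionOf.nonempty_subdividedComplete {U : Type u} {V : Type v} [Nontrivial U]
    {G : SimpleGraph V} (hG : IsSubdivisionOf G (SimpleGraph.completeGraph U)) :
    Nonempty (SubdividedComplete G U) := by
  obtain ⟨φ, P, hpath, hrev, hbr, hmeet, hcov, hedge⟩ := hG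
  let len : U → U → ℕ := fun x y => if h : x ≠ y then (P x y h).length else 0
  let f : U → U → ℕ → V := fun x y t => if h : x ≠ y then (P x y h).getVert t else φ x
  have hlen : ∀ {x y} (h : x ≠ y), len x y = (P x y h).length := fun h => dif_pos h
  have hf : ∀ {x y} (h : x ≠ y) (t), f x y t = (P x y h).getVert t := fun h t => dif_pos h
  have hsymm : ∀ {x y}, x ≠ y → len y x = len x y := fun {x y} h => by
    rw [hlen h, hlen h.symm, hrev x y h, SimpleGraph.Walk.length_reverse]
  have hfsymm : ∀ {x y t}, x ≠ y → t ≤ len x y → f y x (len x y - t) = f x y t := by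
    intro x y t h ht
    rw [hlen h] at ht
    rw [hf h, hf h.symm, hrev x y h, SimpleGraph.Walk.getVert_reverse, hlen h]
    congr 1
    omega
  refine ⟨⟨φ, len, f, fun h => φ.injective h, ?_, ?_, ?_, hsymm, hfsymm, ?_, ?_, ?_, ?_, ?_, ?_⟩⟩
  · intro x y h; rw [hf h, SimpleGraph.Walk.getVert_zero]
  · intro x y h; rw [hf h, hlen h, SimpleGraph.Walk.getVert_length]
  · intro x y h
    rw [hlen h, ← SimpleGraph.Walk.not_nil_iff_lt_length]
    exact fun hn => h (φ.injective hn.eq)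
  · intro x y t h ht
    rw [hf h, hf h]
    exact (P x y h).adj_getVert_succ (by rwa [hlen h] at ht)
  · intro x y s t h hs ht he
    rw [hf h, hf h] at he
    exact (hpath x y h).getVert_injOn (by simpa [hlen h] using hs) (by simpa [hlen h] using ht) he
  · intro x y t z h _ he
    rw [hf h] at he
    exact hbr x y h z (he ▸ SimpleGraph.Walk.getVert_mem_support _ _)
  · intro x y t x' y' t' h h' _ _ he
    by_contra! hcon
    rw [hf h, hf h'] at he
    obtain ⟨z, hz⟩ := hmeet x y h x' y' h' hcon.1 _ (SimpleGraph.Walk.getVert_mem_support _ t)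
      (he ▸ SimpleGraph.Walk.getVert_mem_support _ t')
    exact hcon.2 z (by rw [hf h, hz])
  · intro a
    rcases hcov a with ⟨x, rfl⟩ | ⟨x, y, h, ha⟩
    · obtain ⟨y, hy⟩ := exists_ne x
      exact ⟨x, y, 0, hy.symm, Nat.zero_le _, by rw [hf hy.symm, SimpleGraph.Walk.getVert_zero]⟩
    · obtain ⟨t, ht, hle⟩ := SimpleGraph.Walk.mem_support_iff_exists_getVert.1 ha
      exact ⟨x, y, t, h, by rwa [hlen h], by rw [hf h, ht]⟩
  · intro a b hab
    obtain ⟨x, y, h, he⟩ := hedge s(a, b) hab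
    obtain ⟨t, ht, he⟩ := (SimpleGraph.Walk.mk_mem_edges_iff_exists _).1 he
    rw [← hlen h] at ht
    rw [← hf h, ← hf h, Sym2.eq_iff] at he
    rcases he with ⟨rfl, rfl⟩ | ⟨rfl, rfl⟩
    · exact ⟨x, y, t, h, ht, rfl, rfl⟩
    · have hne : x ≠ y := h
      refine ⟨y, x, len x y - (t + 1), hne.symm, by rw [hsymm hne]; omega, ?_, ?_⟩
      · rw [hfsymm hne (by omega)]
      · rw [show len x y - (t + 1) + 1 = len x y - t by omega, hfsymm hne (by omega)]

namespace SubdividedComplete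

variable {V : Type v} {G : SimpleGraph V} {ι : Type u} {K : SubdividedComplete G ι}

theorem finite {V : Type v} {G : SimpleGraph V} {ι : Type u} [Finite ι]
    (K : SubdividedComplete G ι) : Finite V := by
  rw [← Set.finite_univ_iff]
  have : (⋃ x, ⋃ y, K.f x y '' Set.Iic (K.len x y)).Finite :=
    Set.finite_iUnion fun x => Set.finite_iUnion fun y => (Set.finite_Iic _).image _
  refine this.subset fun a _ => ?_
  obtain ⟨x, y, t, -, ht, rfl⟩ := K.cover a
  simp only [Set.mem_iUnion]
  exact ⟨x, y, t, ht, rfl⟩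

theorem eq_zero_or_len {x y z : ι} {t : ℕ} (h : x ≠ y) (ht : t ≤ K.len x y)
    (he : K.f x y t = K.φ z) : t = 0 ∨ t = K.len x y := by
  rcases K.branch h ht he with rfl | rfl
  · rw [← K.f_zero h] at he
    exact .inl (K.inj h ht (Nat.zero_le _) he)
  · rw [← K.f_len h] at he
    exact .inr (K.inj h ht le_rfl he)

theorem ne_φ {x y z : ι} {t : ℕ} (h : x ≠ y) (h0 : 0 < t) (ht : t < K.len x y) :
    K.f x y t ≠ K.φ z := fun he => by
  have := eq_zero_or_len h ht.le he
  omega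

theorem pair_eq_of_interior {x y x' y' : ι} {t t' : ℕ} (h : x ≠ y) (h' : x' ≠ y') (h0 : 0 < t)
    (ht : t < K.len x y) (ht' : t' ≤ K.len x' y') (he : K.f x y t = K.f x' y' t') :
    s(x, y) = s(x', y') :=
  (K.meet h h' ht.le ht' he).resolve_right fun ⟨_, hz⟩ => ne_φ h h0 ht hz

/-- Along a path, only consecutive vertices are adjacent. -/
theorem chord {x y : ι} {s t : ℕ} (h : x ≠ y) (hs : s ≤ K.len x y) (ht : t ≤ K.len x y)
    (hadj : G.Adj (K.f x y s) (K.f x y t)) : s = t + 1 ∨ t = s + 1 := by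
  obtain ⟨x', y', r, h', hr, h1, h2⟩ := K.cover_adj hadj
  have main : s(x, y) = s(x', y') → s = t + 1 ∨ t = s + 1 := by
    intro he
    rcases Sym2.eq_iff.1 he with ⟨rfl, rfl⟩ | ⟨rfl, rfl⟩
    · have := K.inj h hs hr.le h1
      have := K.inj h ht hr h2
      omega
    · rw [K.len_symm h] at hr
      have e1 := K.f_symm (t := K.len x y - r) h (by omega)
      have e2 := K.f_symm (t := K.len x y - (r + 1)) h (by omega)
      rw [show K.len x y - (K.len x y - r) = r by omega] at e1
      rw [show K.len x y - (K.len x y - (r + 1)) = r + 1 by omega] at e2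
      have := K.inj h hs (by omega) (h1.trans e1)
      have := K.inj h ht (by omega) (h2.trans e2)
      omega
  rcases K.meet h h' hs hr.le h1 with he | ⟨z, hz⟩
  · exact main he
  rcases K.meet h h' ht hr h2 with he | ⟨z', hz'⟩
  · exact main he
  apply main
  have a1 := K.branch h hs hz
  have a2 := K.branch h ht hz'
  have a3 := K.branch h' hr.le (h1 ▸ hz)
  have a4 := K.branch h' hr (h2 ▸ hz')
  have hne : z ≠ z' := fun e => hadj.ne (by rw [hz, hz', e])
  rw [Sym2.eq_iff]
  grind

/-- The neighbours of an interior vertex of a path lie on the path. -/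
theorem adj_interior {x y : ι} {t : ℕ} {w : V} (h : x ≠ y) (h0 : 0 < t) (ht : t < K.len x y)
    (hadj : G.Adj w (K.f x y t)) : ∃ s ≤ K.len x y, w = K.f x y s := by
  obtain ⟨x', y', r, h', hr, h1, h2⟩ := K.cover_adj hadj
  rcases Sym2.eq_iff.1 (pair_eq_of_interior h h' h0 ht hr h2) with ⟨rfl, rfl⟩ | ⟨rfl, rfl⟩
  · exact ⟨r, hr.le, h1⟩
  · rw [K.len_symm h] at hr
    have e1 := K.f_symm (t := K.len x y - r) h (by omega)
    rw [show K.len x y - (K.len x y - r) = r by omega] at e1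
    exact ⟨_, by omega, h1.trans e1⟩

theorem exists_symm {x y : ι} {t : ℕ} (h : x ≠ y) (ht : t ≤ K.len x y) :
    ∃ s ≤ K.len y x, K.f x y t = K.f y x s ∧ s + t = K.len x y ∧ K.len y x = K.len x y :=
  ⟨K.len x y - t, by rw [K.len_symm h]; omega, (K.f_symm h ht).symm, by omega, K.len_symm h⟩

/-- The vertices of the paths between the branch vertices indexed by `T`. -/
def On (K : SubdividedComplete G ι) (T : Set ι) (a : V) : Prop :=
  ∃ x ∈ T, ∃ y ∈ T, ∃ t, x ≠ y ∧ t ≤ K.len x y ∧ a = K.f x y t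

theorem On.mem_of_interior {T : Set ι} {x y : ι} {t : ℕ} (h : x ≠ y) (h0 : 0 < t)
    (ht : t < K.len x y) (hon : K.On T (K.f x y t)) : x ∈ T ∧ y ∈ T := by
  obtain ⟨x', hx', y', hy', t', h', ht', he⟩ := hon
  rcases Sym2.eq_iff.1 (pair_eq_of_interior h h' h0 ht ht' he) with ⟨rfl, rfl⟩ | ⟨rfl, rfl⟩
  · exact ⟨hx', hy'⟩
  · exact ⟨hy', hx'⟩

theorem On.mem_of_φ {T : Set ι} {i : ι} (hon : K.On T (K.φ i)) : i ∈ T := by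
  obtain ⟨x', hx', y', hy', t', h', ht', he⟩ := hon
  rcases K.branch h' ht' he.symm with rfl | rfl
  · exact hx'
  · exact hy'

/-- A vertex is a branch vertex or an interior vertex of a path. -/
theorem branch_or_interior {x y : ι} {t : ℕ} (h : x ≠ y) (ht : t ≤ K.len x y) :
    K.f x y t = K.φ x ∨ K.f x y t = K.φ y ∨ 0 < t ∧ t < K.len x y := by
  rcases Nat.eq_zero_or_pos t with rfl | h0
  · exact .inl (K.f_zero h)
  rcases ht.lt_or_eq with h1 | rfl
  · exact .inr (.inr ⟨h0, h1⟩)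
  · exact .inr (.inl (K.f_len h))

end SubdividedComplete

/-! ### The vertices below a given vertex of a subdivided complete graph -/

namespace SubdividedComplete

variable {V : Type v} {G : SimpleGraph V} {ι : Type u} {K : SubdividedComplete G ι}
  {lt arc : V → V → Prop} (h : IsBurlingOrder lt arc)
  (hadj : ∀ x y, G.Adj x y ↔ arc x y ∨ arc y x)
include h hadj

theorem lt_iff_along {x y : ι} {s t : ℕ} {w : V} (hxy : x ≠ y) (hst : s ≤ t) (ht : t ≤ K.len x y)
    (hno : ∀ r, s ≤ r → r ≤ t → ¬ arc (K.f x y r) w) :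
    lt (K.f x y s) w ↔ lt (K.f x y t) w := by
  induction t, hst using Nat.le_induction with
  | base => rfl
  | succ t hst ih =>
    rw [ih (by omega) fun r h1 h2 => hno r h1 (by omega)]
    exact h.lt_iff_lt_of_adj ((hadj _ _).1 (K.adj hxy (by omega))) (hno t hst (by omega))
      (hno (t + 1) (by omega) le_rfl)

/-- If a subdivision vertex `w` has something below it, then all vertices but `w` and its
in-neighbours are below `w`, because deleting `w` and its neighbours does not disconnect the
graph. -/
theorem eq_or_arc_or_lt_of_interior {x y c : ι} {t : ℕ} {a : V} (hxy : x ≠ y) (hcx : c ≠ x)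
    (hcy : c ≠ y) (h0 : 0 < t) (ht : t < K.len x y) (ha : lt a (K.f x y t)) (b : V) :
    b = K.f x y t ∨ arc b (K.f x y t) ∨ lt b (K.f x y t) := by
  set w := K.f x y t with hw
  have hnbr : ∀ {v}, arc v w → ∃ s ≤ K.len x y, v = K.f x y s := fun hv =>
    adj_interior hxy h0 ht ((hadj _ _).2 (.inl hv))
  have hend : ∀ {j k r}, j ≠ k → k ≠ x → k ≠ y → r ≤ K.len j k → ¬ arc (K.f j k r) w →
      (lt (K.f j k r) w ↔ lt (K.φ k) w) := by
    intro j k r hjk hkx hky hr hno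
    rw [← K.f_len hjk]
    refine lt_iff_along h hadj hjk hr le_rfl fun q hq hq' harc => ?_
    rcases hq.eq_or_lt with rfl | hq
    · exact hno harc
    obtain ⟨s, hs, he⟩ := hnbr harc
    rcases K.meet hjk hxy hq' hs he with hp | ⟨z, hz⟩
    · rcases Sym2.eq_iff.1 hp with ⟨-, rfl⟩ | ⟨-, rfl⟩
      · exact hky rfl
      · exact hkx rfl
    · rcases eq_zero_or_len hjk hq' hz with rfl | rfl
      · omega
      · rw [K.f_len hjk] at he
        exact (K.branch hxy hs he.symm).elim hkx hky
  have hφ : ∀ {k}, ¬ arc (K.φ k) w → (lt (K.φ k) w ↔ lt (K.φ c) w) := by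
    intro k hno
    by_cases hkc : k = c
    · rw [hkc]
    · have := hend (r := 0) hkc hcx hcy (Nat.zero_le _)
      rw [K.f_zero hkc] at this
      exact this hno
  have hfar : ∀ {k}, k ≠ x → k ≠ y → ¬ arc (K.φ k) w := by
    intro k hkx hky harc
    obtain ⟨s, hs, he⟩ := hnbr harc
    exact (K.branch hxy hs he.symm).elim hkx hky
  have hown : ∀ {r}, r ≤ K.len x y → r ≠ t → ¬ arc (K.f x y r) w →
      (lt (K.f x y r) w ↔ lt (K.φ c) w) := by
    intro r hr hrt hno
    have hno' : ∀ q, q ≤ K.len x y → (r < t ∧ q ≤ r ∨ t < r ∧ r ≤ q) → ¬ arc (K.f x y q) w := by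
      intro q hq hqr harc
      have hc := chord hxy hq ht.le ((hadj _ _).2 (.inl harc))
      obtain rfl : q = r := by omega
      exact hno harc
    rcases Nat.lt_or_gt_of_ne hrt with hlt | hgt
    · have hx := hno' 0 (Nat.zero_le _) (.inl ⟨hlt, Nat.zero_le _⟩)
      have := lt_iff_along h hadj hxy (Nat.zero_le r) hr fun q _ hq =>
        hno' q (hq.trans hr) (.inl ⟨hlt, hq⟩)
      rw [K.f_zero hxy] at this hx
      rw [← this, hφ hx]
    · have hy := hno' _ le_rfl (.inr ⟨hgt, hr⟩)
      have := lt_iff_along h hadj hxy hr le_rfl fun q hq hq' => hno' q hq' (.inr ⟨hgt, hq⟩)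
      rw [K.f_len hxy] at this hy
      rw [this, hφ hy]
  have hall : ∀ b, b ≠ w → ¬ arc b w → (lt b w ↔ lt (K.φ c) w) := by
    intro b hbw hno
    obtain ⟨j, k, r, hjk, hr, rfl⟩ := K.cover b
    by_cases hk : k ≠ x ∧ k ≠ y
    · rw [hend hjk hk.1 hk.2 hr hno, hφ (hfar hk.1 hk.2)]
    obtain ⟨s, hs, he, -, -⟩ := exists_symm hjk hr
    by_cases hj : j ≠ x ∧ j ≠ y
    · rw [he] at hno ⊢
      rw [hend hjk.symm hj.1 hj.2 hs hno, hφ (hfar hj.1 hj.2)]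
    have hcase : j = x ∧ k = y ∨ j = y ∧ k = x := by grind
    rcases hcase with ⟨rfl, rfl⟩ | ⟨rfl, rfl⟩
    · exact hown hr (fun e => hbw (by rw [e])) hno
    · rw [he] at hno hbw ⊢
      exact hown hs (fun e => hbw (by rw [e])) hno
  have hac : lt (K.φ c) w :=
    (hall a (fun e => h.irrefl w (e ▸ ha)) fun harc => h.not_lt_of_arc harc ha).1 ha
  by_contra! hcon
  exact hcon.2.2 ((hall b hcon.1 hcon.2.1).2 hac)

omit h hadj in
theorem not_adj_interior {i j k : ι} {r : ℕ} (hjk : j ≠ k) (hij : i ≠ j) (hik : i ≠ k) (h0 : 0 < r)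
    (hr : r < K.len j k) : ¬ G.Adj (K.φ i) (K.f j k r) := fun ha => by
  obtain ⟨s, hs, he⟩ := adj_interior hjk h0 hr ha
  exact (K.branch hjk hs he.symm).elim hij hik

omit h in
theorem not_arc_interior {i j k : ι} {r : ℕ} (hjk : j ≠ k) (hij : i ≠ j) (hik : i ≠ k) (h0 : 0 < r)
    (hr : r < K.len j k) : ¬ arc (K.f j k r) (K.φ i) := fun ha =>
  not_adj_interior hjk hij hik h0 hr ((hadj _ _).2 (.inr ha))

theorem lt_interior_iff {i j k : ι} {r q : ℕ} (hjk : j ≠ k) (hij : i ≠ j) (hik : i ≠ k)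
    (h0 : 0 < r) (hr : r < K.len j k) (h0' : 0 < q) (hq : q < K.len j k) :
    lt (K.f j k r) (K.φ i) ↔ lt (K.f j k q) (K.φ i) := by
  wlog hrq : r ≤ q generalizing r q
  · exact (this h0' hq h0 hr (by omega)).symm
  exact lt_iff_along h hadj hjk hrq hq.le fun p h1 h2 =>
    not_arc_interior hadj hjk hij hik (by omega) (by omega)

theorem lt_interior_iff_end {i j k : ι} {r : ℕ} (hjk : j ≠ k) (hij : i ≠ j) (hik : i ≠ k)
    (h0 : 0 < r) (hr : r < K.len j k) (hk : ¬ arc (K.φ k) (K.φ i)) :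
    lt (K.f j k r) (K.φ i) ↔ lt (K.φ k) (K.φ i) := by
  rw [← K.f_len hjk] at hk ⊢
  refine lt_iff_along h hadj hjk hr.le le_rfl fun p h1 h2 => ?_
  rcases h2.lt_or_eq with h2 | rfl
  · exact not_arc_interior hadj hjk hij hik (by omega) h2
  · exact hk

theorem lt_interior_iff_start {i j k : ι} {r : ℕ} (hjk : j ≠ k) (hij : i ≠ j) (hik : i ≠ k)
    (h0 : 0 < r) (hr : r < K.len j k) (hj : ¬ arc (K.φ j) (K.φ i)) :
    lt (K.f j k r) (K.φ i) ↔ lt (K.φ j) (K.φ i) := by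
  obtain ⟨s, hs, he, h1, h2⟩ := exists_symm hjk hr.le
  rw [he]
  exact lt_interior_iff_end h hadj hjk.symm hik hij (by omega) (by omega) hj

theorem lt_end_of_lt {i k : ι} {r : ℕ} (hik : i ≠ k) (hr : r ≤ K.len i k)
    (hlt : lt (K.f i k r) (K.φ i)) : lt (K.φ k) (K.φ i) := by
  rw [← K.f_zero hik] at hlt ⊢
  rw [← K.f_len hik]
  have h1 : r ≠ 0 := by rintro rfl; exact h.irrefl _ hlt
  have h2 : r ≠ 1 := by
    rintro rfl
    rcases (hadj _ _).1 (K.adj hik (K.len_pos hik)) with ha | ha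
    · exact h.not_gt_of_arc ha hlt
    · exact h.not_lt_of_arc ha hlt
  refine (lt_iff_along h hadj hik hr le_rfl fun q hq hq' ha => ?_).1 hlt
  have := chord hik hq' (Nat.zero_le _) ((hadj _ _).2 (.inl ha))
  omega

/-- If no branch vertex is below the branch vertex `φ i`, then every vertex below it is an interior
vertex of a path between two branch in-neighbours of `φ i`, and the whole interior of this path is
below `φ i`. -/
theorem exists_path_of_lt_of_small {i : ι} {v : V} (hsmall : ∀ b, ¬ lt (K.φ b) (K.φ i))
    (hv : lt v (K.φ i)) : ∃ j k r, j ≠ k ∧ i ≠ j ∧ i ≠ k ∧ 0 < r ∧ r < K.len j k ∧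
      v = K.f j k r ∧ arc (K.φ j) (K.φ i) ∧ arc (K.φ k) (K.φ i) ∧
      ∀ q, 0 < q → q < K.len j k → lt (K.f j k q) (K.φ i) := by
  obtain ⟨j, k, r, hjk, hr, rfl⟩ := K.cover v
  rcases branch_or_interior hjk hr with he | he | ⟨h0, hr'⟩
  · exact absurd (he ▸ hv) (hsmall _)
  · exact absurd (he ▸ hv) (hsmall _)
  have hij : i ≠ j := by
    rintro rfl
    exact hsmall _ (lt_end_of_lt h hadj hjk hr hv)
  have hik : i ≠ k := by
    rintro rfl
    obtain ⟨s, hs, he, -, -⟩ := exists_symm hjk hr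
    exact hsmall _ (lt_end_of_lt h hadj hjk.symm hs (he ▸ hv))
  refine ⟨j, k, r, hjk, hij, hik, h0, hr', rfl, ?_, ?_, fun q hq hq' =>
    (lt_interior_iff h hadj hjk hij hik h0 hr' hq hq').1 hv⟩
  · by_contra hno
    exact hsmall _ ((lt_interior_iff_start h hadj hjk hij hik h0 hr' hno).1 hv)
  · by_contra hno
    exact hsmall _ ((lt_interior_iff_end h hadj hjk hij hik h0 hr' hno).1 hv)

/-- If a branch vertex is below `φ i`, then all branch vertices other than `φ i` and its
in-neighbours are. -/
theorem arc_or_lt_of_big {i b j : ι} (hb : lt (K.φ b) (K.φ i)) (hji : j ≠ i) :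
    arc (K.φ j) (K.φ i) ∨ lt (K.φ j) (K.φ i) := by
  by_cases hbj : b = j
  · exact .inr (hbj ▸ hb)
  have hbi : i ≠ b := by rintro rfl; exact h.irrefl _ hb
  by_contra! hno
  apply hno.2
  rw [← K.f_len hbj] at hno ⊢
  rw [← K.f_zero hbj] at hb
  refine (lt_iff_along h hadj hbj (Nat.zero_le _) le_rfl fun q _ hq ha => ?_).1 hb
  rcases Nat.eq_zero_or_pos q with rfl | h0
  · exact h.not_lt_of_arc ha hb
  rcases hq.lt_or_eq with hq | rfl
  · exact not_arc_interior hadj hbj hbi hji.symm h0 hq ha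
  · exact hno.1 ha

omit h hadj in
variable (K lt arc) in
/-- The path between `φ j` and `φ k` leaves the region below `φ i`: its ends are in-neighbours of
`φ i` and its interior has no vertex below `φ i`. -/
def Outside (i j k : ι) : Prop :=
  arc (K.φ j) (K.φ i) ∧ arc (K.φ k) (K.φ i) ∧
    ∀ r, 0 < r → r < K.len j k → ¬ lt (K.f j k r) (K.φ i)

theorem arc_or_lt_of_not_outside {i b j k : ι} {r : ℕ} (hb : lt (K.φ b) (K.φ i)) (hjk : j ≠ k)
    (hij : i ≠ j) (hik : i ≠ k) (hout : ¬ K.Outside lt arc i j k) (hr : r ≤ K.len j k) :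
    arc (K.f j k r) (K.φ i) ∨ lt (K.f j k r) (K.φ i) := by
  rcases branch_or_interior hjk hr with he | he | ⟨h0, hr'⟩
  · rw [he]; exact arc_or_lt_of_big h hadj hb hij.symm
  · rw [he]; exact arc_or_lt_of_big h hadj hb hik.symm
  right
  by_cases hj : arc (K.φ j) (K.φ i)
  · by_cases hk : arc (K.φ k) (K.φ i)
    · have : ∃ q, 0 < q ∧ q < K.len j k ∧ lt (K.f j k q) (K.φ i) := by
        by_contra! hcon
        exact hout ⟨hj, hk, hcon⟩
      obtain ⟨q, hq, hq', hlt⟩ := this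
      exact (lt_interior_iff h hadj hjk hij hik hq hq' h0 hr').1 hlt
    · rw [lt_interior_iff_end h hadj hjk hij hik h0 hr' hk]
      exact (arc_or_lt_of_big h hadj hb hik.symm).resolve_left hk
  · rw [lt_interior_iff_start h hadj hjk hij hik h0 hr' hj]
    exact (arc_or_lt_of_big h hadj hb hij.symm).resolve_left hj

/-! ### Cycles contain a vertex with two comparable out-neighbours -/

/-- As the arcs are acyclic, the paths between the members of `T` have a common source `a`. It has
two neighbours on these paths, for `T` has at least three members, and these are comparable because
both are out-neighbours of `a`. -/
theorem exists_source [Finite V] {T : Set ι} {x y z : ι} (hx : x ∈ T) (hy : y ∈ T) (hz : z ∈ T)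
    (hxy : x ≠ y) (hxz : x ≠ z) (hyz : y ≠ z) :
    ∃ a u u', K.On T a ∧ K.On T u ∧ K.On T u' ∧ arc a u ∧ arc a u' ∧ lt u' u := by
  have hwf : WellFounded (Relation.TransGen arc) :=
    haveI : IsTrans V (Relation.TransGen arc) := ⟨fun _ _ _ => Relation.TransGen.trans⟩
    haveI : Std.Irrefl (Relation.TransGen arc) := ⟨h.acyclic⟩
    Finite.wellFounded_of_trans_of_irrefl _
  obtain ⟨a, ha, hmin⟩ := hwf.has_min {a | K.On T a}
    ⟨K.f x y 0, x, hx, y, hy, 0, hxy, Nat.zero_le _, rfl⟩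
  have hout : ∀ u, K.On T u → G.Adj a u → arc a u := fun u hu hau =>
    ((hadj _ _).1 hau).resolve_right fun hua => hmin u hu (.single hua)
  have fin : ∀ u u', K.On T u → K.On T u' → G.Adj a u → G.Adj a u' → u ≠ u' →
      ∃ a u u', K.On T a ∧ K.On T u ∧ K.On T u' ∧ arc a u ∧ arc a u' ∧ lt u' u := by
    intro u u' hu hu' hau hau' hne
    have h1 := hout u hu hau
    have h2 := hout u' hu' hau'
    rcases h.lt_or_lt_of_arc h1 h2 hne with h3 | h3
    · exact ⟨a, u', u, ha, hu', hu, h2, h1, h3⟩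
    · exact ⟨a, u, u', ha, hu, hu', h1, h2, h3⟩
  have branch : ∀ j ∈ T, a = K.φ j →
      ∃ a u u', K.On T a ∧ K.On T u ∧ K.On T u' ∧ arc a u ∧ arc a u' ∧ lt u' u := by
    intro j hj haj
    obtain ⟨k, hk, l, hl, hjk, hjl, hkl⟩ : ∃ k ∈ T, ∃ l ∈ T, j ≠ k ∧ j ≠ l ∧ k ≠ l := by grind
    have h1 := K.len_pos hjk
    have h2 := K.len_pos hjl
    refine fin (K.f j k 1) (K.f j l 1) ⟨j, hj, k, hk, 1, hjk, h1, rfl⟩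
      ⟨j, hj, l, hl, 1, hjl, h2, rfl⟩ ?_ ?_ fun he => ?_
    · rw [haj, ← K.f_zero hjk]; exact K.adj hjk h1
    · rw [haj, ← K.f_zero hjl]; exact K.adj hjl h2
    · rcases K.meet hjk hjl h1 h2 he with hp | ⟨c, hc⟩
      · grind [Sym2.eq_iff]
      · have c1 := K.branch hjk h1 hc
        have c2 := K.branch hjl h2 (he ▸ hc)
        obtain rfl : c = j := by grind
        rw [← K.f_zero hjk] at hc
        exact absurd (K.inj hjk h1 (Nat.zero_le _) hc) one_ne_zero
  obtain ⟨j, hj, k, hk, t, hjk, ht, rfl⟩ := id ha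
  rcases branch_or_interior hjk ht with he | he | ⟨h0, ht'⟩
  · exact branch j hj he
  · exact branch k hk he
  · refine fin (K.f j k (t - 1)) (K.f j k (t + 1)) ⟨j, hj, k, hk, _, hjk, by omega, rfl⟩
      ⟨j, hj, k, hk, _, hjk, ht', rfl⟩ ?_ (K.adj hjk ht') fun he => ?_
    · have := K.adj hjk (t := t - 1) (by omega)
      rw [Nat.sub_add_cancel h0] at this
      exact this.symm
    · have := K.inj hjk (by omega) ht' he
      omega

/-! ### At most one path leaves the region below a branch vertex -/

/-- The cycle through `φ i` and a path that leaves the region below `φ i` has a source; the larger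
of its two out-neighbours can only be a vertex of that path above `φ i`. -/
theorem exists_above_of_outside [Finite V] {i j k : ι} (hjk : j ≠ k) (hij : i ≠ j) (hik : i ≠ k)
    (hout : K.Outside lt arc i j k) :
    ∃ r, 0 < r ∧ r < K.len j k ∧ lt (K.φ i) (K.f j k r) := by
  obtain ⟨hj, hk, hint⟩ := hout
  have hshort : ∀ {l}, i ≠ l → arc (K.φ l) (K.φ i) → K.len i l = 1 := by
    intro l hil hl
    rw [← K.f_zero hil, ← K.f_len hil] at hl
    have := chord hil le_rfl (Nat.zero_le _) ((hadj _ _).2 (.inl hl))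
    have := K.len_pos hil
    omega
  have hshort' : ∀ {l}, i ≠ l → arc (K.φ l) (K.φ i) → K.len l i = 1 := fun hil hl => by
    rw [K.len_symm hil, hshort hil hl]
  have form : ∀ {a}, K.On {i, j, k} a → a = K.φ i ∨ a = K.φ j ∨ a = K.φ k ∨
      ∃ r, 0 < r ∧ r < K.len j k ∧ a = K.f j k r := by
    rintro a ⟨p, hp, q, hq, t, hpq, ht, rfl⟩
    rcases branch_or_interior hpq ht with he | he | ⟨h0, ht'⟩
    · rw [he]; rcases hp with rfl | rfl | rfl <;> simp
    · rw [he]; rcases hq with rfl | rfl | rfl <;> simp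
    · refine .inr (.inr (.inr ?_))
      have h1 := hshort hij hj
      have h2 := hshort hik hk
      have h3 := hshort' hij hj
      have h4 := hshort' hik hk
      rcases hp with rfl | rfl | rfl <;> rcases hq with rfl | rfl | rfl <;>
        first | exact absurd rfl hpq | omega | exact ⟨t, h0, ht', rfl⟩ | skip
      obtain ⟨s, hs, he, hst, hlen⟩ := exists_symm hpq ht
      exact ⟨s, by omega, by omega, he⟩
  obtain ⟨a, u, u', -, hu, hu', -, -, hlt⟩ := exists_source h hadj (K := K) (T := {i, j, k})
    (x := i) (y := j) (z := k) (by simp) (by simp) (by simp) hij hik hjk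
  have nbr : ∀ {l}, l = j ∨ l = k → arc (K.φ l) (K.φ i) → u ≠ K.φ l := by
    rintro l hl harc rfl
    by_cases hsmall : ∀ b, ¬ lt (K.φ b) (K.φ l)
    · obtain ⟨p, q, r, hpq, hp, hq, h0, hr, rfl, -, -, -⟩ :=
        exists_path_of_lt_of_small h hadj hsmall hlt
      rcases form hu' with he | he | he | ⟨s, h0', hs, he⟩
      · exact ne_φ hpq h0 hr he
      · exact ne_φ hpq h0 hr he
      · exact ne_φ hpq h0 hr he
      · have := pair_eq_of_interior hpq hjk h0 hr hs.le he
        grind [Sym2.eq_iff]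
    · push Not at hsmall
      obtain ⟨b, hb⟩ := hsmall
      have hil : i ≠ l := by rcases hl with rfl | rfl <;> assumption
      rcases arc_or_lt_of_big h hadj hb hil with h1 | h1
      · exact h.asymm_arc h1 harc
      · exact h.not_gt_of_arc harc h1
  rcases form hu with rfl | he | he | ⟨r, h0, hr, rfl⟩
  · rcases form hu' with rfl | rfl | rfl | ⟨r, h0, hr, rfl⟩
    · exact absurd hlt (h.irrefl _)
    · exact absurd hlt (h.not_lt_of_arc hj)
    · exact absurd hlt (h.not_lt_of_arc hk)
    · exact absurd hlt (hint r h0 hr)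
  · exact absurd he (nbr (.inl rfl) hj)
  · exact absurd he (nbr (.inr rfl) hk)
  · refine ⟨r, h0, hr, ?_⟩
    rcases eq_or_arc_or_lt_of_interior h hadj hjk hij hik h0 hr hlt (K.φ i) with h1 | h1 | h1
    · exact absurd h1.symm (ne_φ hjk h0 hr)
    · exact absurd ((hadj _ _).2 (.inl h1)) (not_adj_interior hjk hij hik h0 hr)
    · exact h1

theorem outside_unique [Finite V] {i j k j' k' : ι} (hjk : j ≠ k) (hij : i ≠ j) (hik : i ≠ k)
    (hjk' : j' ≠ k') (hij' : i ≠ j') (hik' : i ≠ k') (hout : K.Outside lt arc i j k)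
    (hout' : K.Outside lt arc i j' k') : s(j, k) = s(j', k') := by
  obtain ⟨r, h0, hr, hlt⟩ := exists_above_of_outside h hadj hjk hij hik hout
  obtain ⟨r', h0', hr', hlt'⟩ := exists_above_of_outside h hadj hjk' hij' hik' hout'
  -- Everything but a subdivision vertex above `φ i` and its in-neighbours lies below that vertex,
  -- so there are no two of them on a chain.
  rcases h.comparable_of_lt hlt hlt' with he | hc | hc
  · exact pair_eq_of_interior hjk hjk' h0 hr hr'.le he
  · rcases eq_or_arc_or_lt_of_interior h hadj hjk hij hik h0 hr hlt (K.f j' k' r') with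
      h1 | h1 | h1
    · exact absurd hc (h1 ▸ h.irrefl _)
    · exact absurd hc (h.not_gt_of_arc h1)
    · exact absurd (h.trans hc h1) (h.irrefl _)
  · rcases eq_or_arc_or_lt_of_interior h hadj hjk' hij' hik' h0' hr' hlt' (K.f j k r) with
      h1 | h1 | h1
    · exact absurd hc (h1 ▸ h.irrefl _)
    · exact absurd hc (h.not_gt_of_arc h1)
    · exact absurd (h.trans hc h1) (h.irrefl _)

/-! ### Triangles with an apex -/

omit h hadj in
variable (K lt arc) in
/-- The branch vertex `φ i` is an apex of the set `T` of branch vertices: no branch vertex is below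
`φ i`, the other members of `T` are in-neighbours of `φ i`, and the paths between them are
subdivided and have their interior below `φ i`. -/
structure IsApex (T : Set ι) (i : ι) : Prop where
  mem : i ∈ T
  small : ∀ b, ¬ lt (K.φ b) (K.φ i)
  arc : ∀ j ∈ T, j ≠ i → arc (K.φ j) (K.φ i)
  below : ∀ j ∈ T, ∀ k ∈ T, j ≠ i → k ≠ i → j ≠ k → 1 < K.len j k ∧
    ∀ q, 0 < q → q < K.len j k → lt (K.f j k q) (K.φ i)

theorem exists_apex {x y z : ι} (hι : ∀ x y : ι, ∃ c, c ≠ x ∧ c ≠ y) {u u' : V}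
    (hu : K.On {x, y, z} u) (hu' : K.On {x, y, z} u') (hlt : lt u' u)
    (hsmall : ∀ b, ¬ lt (K.φ b) u) : ∃ i, K.IsApex lt arc {x, y, z} i := by
  obtain ⟨i, rfl⟩ : ∃ i, u = K.φ i := by
    obtain ⟨p, -, q, -, t, hpq, ht, rfl⟩ := hu
    rcases branch_or_interior hpq ht with he | he | ⟨h0, ht'⟩
    · exact ⟨p, he⟩
    · exact ⟨q, he⟩
    obtain ⟨c, hcp, hcq⟩ := hι p q
    rcases eq_or_arc_or_lt_of_interior h hadj hpq hcp hcq h0 ht' hlt (K.φ c) with h1 | h1 | h1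
    · exact absurd h1.symm (ne_φ hpq h0 ht')
    · exact absurd ((hadj _ _).2 (.inl h1)) (not_adj_interior hpq hcp hcq h0 ht')
    · exact absurd h1 (hsmall c)
  obtain ⟨j, k, r, hjk, hij, hik, h0, hr, rfl, hj, hk, hint⟩ :=
    exists_path_of_lt_of_small h hadj hsmall hlt
  have hi := hu.mem_of_φ
  obtain ⟨hjT, hkT⟩ := hu'.mem_of_interior hjk h0 hr
  have hT : ∀ l ∈ ({x, y, z} : Set ι), l ≠ i → l = j ∨ l = k := by
    intro l hl hli
    simp only [Set.mem_insert_iff, Set.mem_singleton_iff] at *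
    grind
  refine ⟨i, hi, hsmall, fun l hl hli => ?_, fun l hl m hm hli hmi hlm => ?_⟩
  · rcases hT l hl hli with rfl | rfl <;> assumption
  · rcases hT l hl hli with rfl | rfl <;> rcases hT m hm hmi with rfl | rfl
    · exact absurd rfl hlm
    · exact ⟨by omega, hint⟩
    · refine ⟨by rw [K.len_symm hjk]; omega, fun q hq hq' => ?_⟩
      obtain ⟨s, hs, he, hsq, hlen⟩ := exists_symm hlm hq'.le
      rw [he]
      exact hint s (by omega) (by omega)
    · exact absurd rfl hlm

/-- Two triangles that share an edge do not both have an apex. -/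
theorem IsApex.false_of_common_edge {x y c d i i' : ι} (hxc : x ≠ c) (hxd : x ≠ d) (hyc : y ≠ c)
    (hyd : y ≠ d) (hxy : x ≠ y) (hcd : c ≠ d) (hi : K.IsApex lt arc {x, c, d} i)
    (hi' : K.IsApex lt arc {y, c, d} i') : False := by
  by_cases hii : i = i'
  · -- The common apex is `c` or `d`; the other one of them has an out-neighbour in either path
    -- to `x` and `y`. These are comparable subdivision vertices, both below the apex.
    subst hii
    obtain ⟨e, he, he', hei⟩ : ∃ e ∈ ({x, c, d} : Set ι), e ∈ ({y, c, d} : Set ι) ∧ e ≠ i := by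
      by_cases hci : c = i
      · exact ⟨d, by simp, by simp, hci ▸ hcd.symm⟩
      · exact ⟨c, by simp, by simp, hci⟩
    have hicd : i = c ∨ i = d := by
      have h1 := hi.mem
      have h2 := hi'.mem
      simp only [Set.mem_insert_iff, Set.mem_singleton_iff] at h1 h2
      grind
    have hecd : e = c ∨ e = d := by
      simp only [Set.mem_insert_iff, Set.mem_singleton_iff] at he he'
      grind
    have hxi : x ≠ i := by rcases hicd with rfl | rfl <;> assumption
    have hyi : y ≠ i := by rcases hicd with rfl | rfl <;> assumption
    have hex : e ≠ x := by rcases hecd with rfl | rfl <;> exact Ne.symm ‹_›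
    have hey : e ≠ y := by rcases hecd with rfl | rfl <;> exact Ne.symm ‹_›
    have out : ∀ {z}, e ≠ z → 1 < K.len e z →
        (∀ q, 0 < q → q < K.len e z → lt (K.f e z q) (K.φ i)) →
        arc (K.φ e) (K.f e z 1) := by
      intro z hez hlen hbelow
      have := K.adj hez (K.len_pos hez)
      rw [K.f_zero hez] at this
      refine ((hadj _ _).1 this).resolve_right fun harc => ?_
      exact hi.small e (h.lt_of_arc_of_lt harc (hbelow 1 one_pos hlen))
    obtain ⟨hlx, hbx⟩ := hi.below e he x (by simp) hei hxi hex
    obtain ⟨hly, hby⟩ := hi'.below e he' y (by simp) hei hyi hey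
    have hne : s(e, x) ≠ s(e, y) := by grind [Sym2.eq_iff]
    have key : ∀ {z z'}, e ≠ z → z ≠ i → 1 < K.len e z → lt (K.f e z 1) (K.φ i) →
        ¬ lt (K.f e z' 1) (K.f e z 1) := by
      intro z z' hez hzi hlen hz hlt
      rcases eq_or_arc_or_lt_of_interior h hadj hez hei.symm hzi.symm one_pos hlen hlt (K.φ i) with
        h1 | h1 | h1
      · exact h.irrefl _ (h1 ▸ hz)
      · exact h.not_gt_of_arc h1 hz
      · exact h.irrefl _ (h.trans h1 hz)
    rcases h.comparable_of_arc (out hex hlx hbx) (out hey hly hby) with h1 | h1 | h1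
    · exact hne (pair_eq_of_interior hex hey one_pos hlx hly.le h1)
    · exact key hey hyi hly (hby 1 one_pos hly) h1
    · exact key hex hxi hlx (hbx 1 one_pos hlx) h1
  · have two : ∀ e ∈ ({x, c, d} : Set ι), e ∈ ({y, c, d} : Set ι) → e = i ∨ e = i' := by
      intro e he he'
      by_contra! hcon
      rcases h.lt_or_lt_of_arc (hi.arc e he hcon.1) (hi'.arc e he' hcon.2)
        (fun h1 => hii (K.φ_inj h1)) with h1 | h1
      · exact hi'.small _ h1
      · exact hi.small _ h1
    have hc := two c (by simp) (by simp)
    have hd := two d (by simp) (by simp)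
    have : i = c ∧ i' = d ∨ i = d ∧ i' = c := by grind
    rcases this with ⟨rfl, rfl⟩ | ⟨rfl, rfl⟩
    · exact h.asymm_arc (hi.arc _ (by simp) hcd.symm) (hi'.arc _ (by simp) hcd)
    · exact h.asymm_arc (hi.arc _ (by simp) hcd) (hi'.arc _ (by simp) hcd.symm)

/-- If no vertex below `s` has a branch vertex below it, then a triangle has an apex as soon as all
vertices of its three paths are below `s` or in-neighbours of `s`. -/
theorem exists_apex_of_arc_or_lt [Finite V] {x y z : ι} (hι : ∀ x y : ι, ∃ c, c ≠ x ∧ c ≠ y)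
    (hxy : x ≠ y) (hxz : x ≠ z) (hyz : y ≠ z) {s : V}
    (hs : ∀ w, lt w s → ∀ b, ¬ lt (K.φ b) w)
    (hT : ∀ a, K.On {x, y, z} a → arc a s ∨ lt a s) : ∃ i, K.IsApex lt arc {x, y, z} i := by
  obtain ⟨a, u, u', ha, hu, hu', hau, hau', hlt⟩ := exists_source h hadj (K := K) (T := {x, y, z})
    (x := x) (y := y) (z := z) (by simp) (by simp) (by simp) hxy hxz hyz
  refine exists_apex h hadj hι hu hu' hlt (hs u ((hT u hu).resolve_left fun hus => ?_))
  rcases hT a ha with has | has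
  · rcases h.comparable_of_arc hau has with rfl | h1 | h1
    · exact h.asymm_arc hus hus
    · exact h.not_lt_of_arc hus h1
    · exact h.not_gt_of_arc hus h1
  · exact h.not_lt_of_arc hus (h.lt_of_arc_of_lt hau has)

end SubdividedComplete

/-! ### No subdivision of the complete graph on five vertices -/

open SubdividedComplete in
theorem IsSubdivisionOf.not_hasBurlingOrder {V : Type v} {G : SimpleGraph V}
    (hG : IsSubdivisionOf G (SimpleGraph.completeGraph (Fin 5))) : ¬ HasBurlingOrder G := by
  rintro ⟨lt, arc, h, hadj⟩
  obtain ⟨K⟩ := hG.nonempty_subdividedComplete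
  have : Finite V := K.finite
  have hι : ∀ x y : Fin 5, ∃ c, c ≠ x ∧ c ≠ y := by decide
  have hι2 : ∀ x y : Fin 5, ∃ c d, c ≠ x ∧ c ≠ y ∧ d ≠ x ∧ d ≠ y ∧ c ≠ d := by decide
  have hι3 : ∀ i j k : Fin 5, ∃ c d, c ≠ i ∧ c ≠ j ∧ c ≠ k ∧ d ≠ i ∧ d ≠ j ∧ d ≠ k ∧ c ≠ d := by
    decide
  by_cases hbig : ∃ s b, lt (K.φ b) s
  · have hwf : WellFounded lt :=
      haveI : IsTrans V lt := ⟨fun _ _ _ => h.trans⟩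
      haveI : Std.Irrefl lt := ⟨h.irrefl⟩
      Finite.wellFounded_of_trans_of_irrefl _
    -- A lowest vertex that has a branch vertex below it.
    obtain ⟨s, ⟨b, hb⟩, hmin⟩ := hwf.has_min {s | ∃ b, lt (K.φ b) s} hbig
    have hs : ∀ w, lt w s → ∀ b, ¬ lt (K.φ b) w := fun w hw b hb => hmin w ⟨b, hb⟩ hw
    have key : ∀ {x y c d : Fin 5}, x ≠ y → c ≠ x → c ≠ y → d ≠ x → d ≠ y → c ≠ d →
        (∀ a, K.On {x, c, d} a → arc a s ∨ lt a s) →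
        (∀ a, K.On {y, c, d} a → arc a s ∨ lt a s) → False := by
      intro x y c d hxy hcx hcy hdx hdy hcd h1 h2
      obtain ⟨i, hi⟩ := exists_apex_of_arc_or_lt h hadj hι hcx.symm hdx.symm hcd hs h1
      obtain ⟨i', hi'⟩ := exists_apex_of_arc_or_lt h hadj hι hcy.symm hdy.symm hcd hs h2
      exact hi.false_of_common_edge h hadj hcx.symm hdx.symm hcy.symm hdy.symm hxy hcd hi'
    obtain ⟨p, q, t, hpq, ht, rfl⟩ := K.cover s
    by_cases hbranch : ∃ i, K.f p q t = K.φ i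
    · obtain ⟨i, hi⟩ := hbranch
      rw [hi] at hb key
      -- Only the path between `φ j` and `φ k` may leave the region below `φ i`.
      obtain ⟨j, k, hjk, hij, hik, hout⟩ : ∃ j k, j ≠ k ∧ i ≠ j ∧ i ≠ k ∧
          ∀ j' k', j' ≠ k' → i ≠ j' → i ≠ k' → K.Outside lt arc i j' k' → s(j, k) = s(j', k') := by
        by_cases hex : ∃ j k, j ≠ k ∧ i ≠ j ∧ i ≠ k ∧ K.Outside lt arc i j k
        · obtain ⟨j, k, hjk, hij, hik, ho⟩ := hex
          exact ⟨j, k, hjk, hij, hik, fun j' k' h1 h2 h3 h4 =>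
            outside_unique h hadj hjk hij hik h1 h2 h3 ho h4⟩
        · obtain ⟨j, k, hji, -, hki, -, hjk⟩ := hι2 i i
          exact ⟨j, k, hjk, hji.symm, hki.symm, fun j' k' h1 h2 h3 h4 =>
            absurd ⟨j', k', h1, h2, h3, h4⟩ hex⟩
      obtain ⟨c, d, hci, hcj, hck, hdi, hdj, hdk, hcd⟩ := hι3 i j k
      have region : ∀ T : Set (Fin 5), i ∉ T → (j ∉ T ∨ k ∉ T) →
          ∀ a, K.On T a → arc a (K.φ i) ∨ lt a (K.φ i) := by
        rintro T hiT hjkT a ⟨x, hx, y, hy, r, hxy, hr, rfl⟩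
        have hix : i ≠ x := fun e => hiT (e ▸ hx)
        have hiy : i ≠ y := fun e => hiT (e ▸ hy)
        refine arc_or_lt_of_not_outside h hadj hb hxy hix hiy (fun ho => ?_) hr
        rcases Sym2.eq_iff.1 (hout x y hxy hix hiy ho) with ⟨rfl, rfl⟩ | ⟨rfl, rfl⟩
        · exact hjkT.elim (· hx) (· hy)
        · exact hjkT.elim (· hy) (· hx)
      refine key hjk hcj hck hdj hdk hcd (region _ ?_ (.inr ?_)) (region _ ?_ (.inl ?_)) <;>
        simp only [Set.mem_insert_iff, Set.mem_singleton_iff] <;> grind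
    · have h0t : 0 < t ∧ t < K.len p q := by
        rcases branch_or_interior hpq ht with he | he | he
        · exact absurd ⟨_, he⟩ hbranch
        · exact absurd ⟨_, he⟩ hbranch
        · exact he
      obtain ⟨c, d, hcp, hcq, hdp, hdq, hcd⟩ := hι2 p q
      have region : ∀ T : Set (Fin 5), (p ∉ T ∨ q ∉ T) →
          ∀ a, K.On T a → arc a (K.f p q t) ∨ lt a (K.f p q t) := by
        intro T hT a ha
        refine (eq_or_arc_or_lt_of_interior h hadj hpq hcp hcq h0t.1 h0t.2 hb a).resolve_left ?_
        rintro rfl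
        obtain ⟨h1, h2⟩ := ha.mem_of_interior hpq h0t.1 h0t.2
        exact hT.elim (· h1) (· h2)
      refine key hpq hcp hcq hdp hdq hcd (region _ (.inr ?_)) (region _ (.inl ?_)) <;>
        simp only [Set.mem_insert_iff, Set.mem_singleton_iff] <;> grind
  · push Not at hbig
    have key : ∀ {x y z : Fin 5}, x ≠ y → x ≠ z → y ≠ z →
        ∃ i, K.IsApex lt arc {x, y, z} i := by
      intro x y z hxy hxz hyz
      obtain ⟨a, u, u', ha, hu, hu', hau, hau', hlt⟩ := exists_source h hadj (K := K)
        (T := {x, y, z}) (x := x) (y := y) (z := z) (by simp) (by simp) (by simp) hxy hxz hyz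
      exact exists_apex h hadj hι hu hu' hlt (hbig u)
    obtain ⟨i, hi⟩ := key (x := 0) (y := 2) (z := 3) (by decide) (by decide) (by decide)
    obtain ⟨i', hi'⟩ := key (x := 1) (y := 2) (z := 3) (by decide) (by decide) (by decide)
    exact hi.false_of_common_edge h hadj (by decide) (by decide) (by decide) (by decide)
      (by decide) (by decide) hi'

theorem mainTheorem1 {V : Type v} (G : SimpleGraph V)
    (hG : IsSubdivisionOf G (SimpleGraph.completeGraph (Fin 5))) :
    ¬ IsDerived.{v, w} G ∧ ¬ IsBurling G :=
  ⟨fun hd => hG.not_hasBurlingOrder hd.hasBurlingOrder,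
    fun hb => hG.not_hasBurlingOrder hb.hasBurlingOrder⟩
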